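/- Let $n\ge 0$, $m=2n$, $\mathbf m=\{1,\dots,m\}$ and $\bar i=m+1-i$. A subset $P\subseteq\mathbf m$ is admissible if $P=\mathbf m$ or if $\bar i\notin P$ for all $i\in P$. Let $W_n=WSp_{2n}$ be the group of permutations of $\mathbf m$ that send admissible sets to admissible sets, and let $RSp_{2n}$ be the monoid, under composition $(\sigma\tau)(i)=\sigma(\tau(i))$, of the injective partial transformations of $\mathbf m$ that either lie in $W_n$ or have both domain and range proper admissible subsets. The rank of an element is the size of its domain. Let $0\le t\le n$ and let $e_t\in RSp_{2n}$ be the identity map of $\{1,\dots,t\}$. Embed $S_t\times W_{n-t}$ in $W_n$ by letting $s\in S_t$ act by $i\mapsto s(i)$, $\bar i\mapsto\overline{s(i)}$ for $1\le i\le t$, and letting $W_{n-t}$ act on the remaining points $t+1,\dots,2n-t$ (identified with $1,\dots,2(n-t)$ by $i\mapsto i-t$). Then $s\mapsto se_t$ identifies $S_t$ with a subgroup of $RSp_{2n}$ with identity $e_t$. Let $\overline\chi$ be an irreducible complex character of $S_t$; these are the characters $\overline\chi_\alpha$ indexed by the partitions $\alpha\vdash t$. An irreducible complex representation $V$ of $RSp_{2n}$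 is attached to $\overline\chi$ if every element of rank less than $t$ acts by $0$ on $V$ and the representation of $S_t$ on $e_tV$ given by $s\mapsto se_t$ has character $\overline\chi$. **Proposition.** There is exactly one character $\chi$ of an irreducible representation of $RSp_{2n}$ attached to $\overline\chi$ (it is $\chi_\alpha$ when $\overline\chi=\overline\chi_\alpha$), and $$\chi|_{W_n}=\operatorname{Ind}_{S_t\times W_{n-t}}^{W_n}\bigl(\overline\chi\boxtimes\eta_{n-t}\bigr),$$ where $\eta_{n-t}$ is the trivial character of $W_{n-t}$. -/

import Mathlib

open scoped TensorProduct

namespace SymplecticRook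

/-- The set `{1, …, 2n}` is modelled by `Fin (2 * n)`, and the bar involution `i ↦ 2n + 1 - i` by
`Fin.rev`. A subset is admissible if it is everything or if it contains no pair `{i, bar i}`. -/
def Admissible {n : ℕ} (P : Set (Fin (2 * n))) : Prop :=
  P = Set.univ ∨ ∀ i ∈ P, Fin.rev i ∉ P

/-- Proper admissible subsets. -/
def ProperAdmissible {n : ℕ} (P : Set (Fin (2 * n))) : Prop :=
  P ≠ Set.univ ∧ Admissible P

theorem ProperAdmissible.mono {n : ℕ} {P Q : Set (Fin (2 * n))} (hP : ProperAdmissible P)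
    (h : Q ⊆ P) : ProperAdmissible Q := by
  refine ⟨fun hQ => hP.1 (Set.univ_subset_iff.1 (hQ ▸ h)), Or.inr fun i hi hi' => ?_⟩
  rcases hP.2 with h1 | h1
  · exact hP.1 h1
  · exact h1 i (h hi) (h hi')

theorem rev_ne {n : ℕ} (i : Fin (2 * n)) : Fin.rev i ≠ i := by
  intro h
  have := congrArg Fin.val h
  rw [Fin.val_rev] at this
  omega

/-- A permutation sends admissible sets to admissible sets iff it commutes with the bar
involution. -/
theorem admissible_image_iff {n : ℕ} (σ : Equiv.Perm (Fin (2 * n))) :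
    (∀ P, Admissible P → Admissible (σ '' P)) ↔ ∀ i, σ (Fin.rev i) = Fin.rev (σ i) := by
  constructor
  · intro h i
    by_contra hne
    obtain ⟨j, hj⟩ := σ.surjective (Fin.rev (σ i))
    have hji : j ≠ i := by
      rintro rfl
      exact rev_ne _ hj.symm
    have hjr : j ≠ Fin.rev i := by
      rintro rfl
      exact hne hj
    have hP : Admissible ({i, j} : Set (Fin (2 * n))) := by
      right
      rintro k (rfl | rfl) (h1 | h1)
      · exact rev_ne _ h1
      · exact hjr h1.symm
      · exact hjr (by rw [← h1, Fin.rev_rev])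
      · exact rev_ne _ h1
    rcases h _ hP with h1 | h1
    · have h2 : σ (Fin.rev i) ∈ σ '' ({i, j} : Set (Fin (2 * n))) := h1 ▸ Set.mem_univ _
      rw [σ.injective.mem_set_image] at h2
      rcases h2 with h2 | h2
      · exact rev_ne _ h2
      · exact hjr h2.symm
    · exact h1 (σ i) ⟨i, by simp, rfl⟩ ⟨j, by simp, hj⟩
  · rintro h P (rfl | hP)
    · left
      simp
    · right
      rintro _ ⟨i, hi, rfl⟩
      rw [← h, σ.injective.mem_set_image]
      exact hP i hi

/-- The Weyl group `W_n = WSp_{2n}`: the permutations of `{1, …, 2n}` that send admissible sets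
to admissible sets. -/
def WSp (n : ℕ) : Subgroup (Equiv.Perm (Fin (2 * n))) where
  carrier := {σ | ∀ P, Admissible P → Admissible (σ '' P)}
  one_mem' := fun P hP => by simpa using hP
  mul_mem' := fun {σ τ} hσ hτ P hP => by
    have := hσ _ (hτ P hP)
    rwa [← Set.image_comp] at this
  inv_mem' := fun {σ} hσ => by
    have h := (admissible_image_iff σ).1 hσ
    refine (admissible_image_iff σ⁻¹).2 fun i => σ.injective ?_
    rw [h]
    simp

/-- The domain of an injective partial transformation. -/
def dom {m : ℕ} (f : Fin m ≃. Fin m) : Set (Fin m) := {i | (f i).isSome}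

/-- An injective partial transformation of `{1, …, 2n}` is symplectic if it is a bijection sending
admissible sets to admissible sets, or if its domain and its range are both proper admissible. -/
def IsSymplectic {n : ℕ} (f : Fin (2 * n) ≃. Fin (2 * n)) : Prop :=
  (∃ w ∈ WSp n, f = w.toPEquiv) ∨ (ProperAdmissible (dom f) ∧ ProperAdmissible (dom f.symm))

theorem dom_trans_subset {m : ℕ} (f g : Fin m ≃. Fin m) : dom (f.trans g) ⊆ dom f := by
  intro i hi
  obtain ⟨c, hc⟩ := Option.isSome_iff_exists.1 hi
  obtain ⟨b, hb, -⟩ := (PEquiv.trans_eq_some f g i c).1 hc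
  exact Option.isSome_iff_exists.2 ⟨b, hb⟩

theorem dom_perm_trans {n : ℕ} {w : Equiv.Perm (Fin (2 * n))} (hw : w ∈ WSp n)
    {g : Fin (2 * n) ≃. Fin (2 * n)} (hg : ProperAdmissible (dom g)) :
    ProperAdmissible (dom (w.toPEquiv.trans g)) := by
  have h : dom (w.toPEquiv.trans g) = (w⁻¹ : Equiv.Perm (Fin (2 * n))) '' dom g := by
    ext i
    constructor
    · exact fun hi => ⟨w i, hi, by simp⟩
    · rintro ⟨j, hj, rfl⟩
      have h1 : (w.toPEquiv.trans g) (w⁻¹ j) = g (w (w⁻¹ j)) := rfl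
      have h2 : (g j).isSome := hj
      rw [dom, Set.mem_ofPred_eq, h1]
      simpa using h2
  refine ⟨fun hu => hg.1 ?_, h ▸ inv_mem hw _ hg.2⟩
  refine Set.eq_univ_of_forall fun j => ?_
  obtain ⟨k, hk, hk'⟩ := (h ▸ hu) ▸ Set.mem_univ (w⁻¹ j)
  rwa [← (w⁻¹).injective hk']

theorem IsSymplectic.trans {n : ℕ} {f g : Fin (2 * n) ≃. Fin (2 * n)}
    (hf : IsSymplectic f) (hg : IsSymplectic g) : IsSymplectic (f.trans g) := by
  rcases hf with ⟨v, hv, rfl⟩ | hf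
  · rcases hg with ⟨w, hw, rfl⟩ | hg
    · exact Or.inl ⟨w * v, mul_mem hw hv, (Equiv.toPEquiv_trans v w).symm⟩
    · refine Or.inr ⟨dom_perm_trans hv hg.1, hg.2.mono ?_⟩
      rw [PEquiv.symm_trans_rev]
      exact dom_trans_subset _ _
  · rcases hg with ⟨w, hw, rfl⟩ | hg
    · refine Or.inr ⟨hf.1.mono (dom_trans_subset _ _), ?_⟩
      rw [PEquiv.symm_trans_rev, ← Equiv.toPEquiv_symm]
      exact dom_perm_trans (inv_mem hw) hf.2
    · refine Or.inr ⟨hf.1.mono (dom_trans_subset _ _), hg.2.mono ?_⟩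
      rw [PEquiv.symm_trans_rev]
      exact dom_trans_subset _ _

/-- The symplectic Renner monoid `RSp_{2n}`, also called the symplectic rook monoid. -/
def RSp (n : ℕ) : Type := {f : Fin (2 * n) ≃. Fin (2 * n) // IsSymplectic f}

/-- The product is composition of partial maps acting from the left: first `τ`, then `σ`. -/
instance (n : ℕ) : Monoid (RSp n) where
  mul σ τ := ⟨τ.1.trans σ.1, τ.2.trans σ.2⟩
  one := ⟨PEquiv.refl _, Or.inl ⟨1, one_mem _, Equiv.toPEquiv_refl.symm⟩⟩
  mul_assoc σ τ υ := Subtype.ext (PEquiv.trans_assoc υ.1 τ.1 σ.1).symm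
  one_mul σ := Subtype.ext (PEquiv.trans_refl σ.1)
  mul_one σ := Subtype.ext (PEquiv.refl_trans σ.1)

/-- The rank of a partial transformation is the size of its domain. -/
noncomputable def rank {n : ℕ} (σ : RSp n) : ℕ := (dom σ.1).ncard

/-- The Weyl group inside the symplectic Renner monoid. -/
def ofWSp (n : ℕ) : WSp n →* RSp n where
  toFun w := ⟨w.1.toPEquiv, Or.inl ⟨w.1, w.2, rfl⟩⟩
  map_one' := Subtype.ext Equiv.toPEquiv_refl
  map_mul' v w := Subtype.ext (Equiv.toPEquiv_trans w.1 v.1)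

/-- The idempotent `e_t`: the identity map of the subset `{1, …, t}`, for `t ≤ n`. -/
def idem {n t : ℕ} (ht : t ≤ n) : RSp n :=
  ⟨PEquiv.ofSet {i : Fin (2 * n) | i.val < t}, by
    have hd : dom (PEquiv.ofSet {i : Fin (2 * n) | i.val < t}) = {i | i.val < t} := by
      ext i
      rw [dom, Set.mem_ofPred_eq, Option.isSome_iff_exists]
      constructor
      · rintro ⟨j, hj⟩
        obtain ⟨rfl, h⟩ := PEquiv.ofSet_eq_some_iff.1 hj
        exact h
      · exact fun h => ⟨i, PEquiv.ofSet_eq_some_self_iff.2 h⟩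
    rcases Nat.eq_zero_or_pos n with rfl | hn
    · exact Or.inl ⟨1, one_mem _, PEquiv.ext fun i => i.elim0⟩
    · have hP : ProperAdmissible {i : Fin (2 * n) | i.val < t} := by
        refine ⟨fun h => ?_, Or.inr fun i hi hi' => ?_⟩
        · have h1 : (⟨2 * n - 1, by omega⟩ : Fin (2 * n)) ∈ {i : Fin (2 * n) | i.val < t} :=
            h ▸ Set.mem_univ _
          have h2 : 2 * n - 1 < t := h1
          omega
        · have h1 : i.val < t := hi
          have h2 : (Fin.rev i).val < t := hi'
          rw [Fin.val_rev] at h2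
          omega
      right
      rw [PEquiv.ofSet_symm, hd]
      exact ⟨hP, hP⟩⟩

/-- The decomposition of `{1, …, 2n}` into the consecutive blocks `{1, …, t}`,
`{t + 1, …, 2n - t}` and `{2n - t + 1, …, 2n}`; the bar involution exchanges the two outer
blocks. -/
def blocks {n t : ℕ} (ht : t ≤ n) : Fin t ⊕ (Fin (2 * (n - t)) ⊕ Fin t) ≃ Fin (2 * n) :=
  ((Equiv.sumCongr (Equiv.refl _) finSumFinEquiv).trans finSumFinEquiv).trans
    (finCongr (by omega))

theorem rev_blocks {n t : ℕ} (ht : t ≤ n) (x : Fin t ⊕ (Fin (2 * (n - t)) ⊕ Fin t)) :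
    Fin.rev (blocks ht x) = blocks ht (match x with
      | .inl i => .inr (.inr (Fin.rev i))
      | .inr (.inl j) => .inr (.inl (Fin.rev j))
      | .inr (.inr i) => .inl (Fin.rev i)) := by
  rcases x with i | j | i <;> ext <;> simp [blocks, Fin.val_rev] <;> omega

/-- The embedding `S_t × W_{n-t} → W_n`: `S_t` permutes `{1, …, t}`, and correspondingly
`{bar 1, …, bar t}`, while `W_{n-t}` acts on the remaining `2 (n - t)` points. -/
def embed {n t : ℕ} (ht : t ≤ n) : Equiv.Perm (Fin t) × WSp (n - t) →* WSp n where
  toFun g := ⟨(blocks ht).permCongr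
      (Equiv.sumCongr g.1 (Equiv.sumCongr g.2.1 (Fin.revPerm.permCongr g.1))), by
    refine (admissible_image_iff _).2 fun i => ?_
    obtain ⟨x, rfl⟩ := (blocks ht).surjective i
    have h := (admissible_image_iff _).1 g.2.2
    rcases x with i | j | i <;>
      simp [rev_blocks, Equiv.permCongr_apply, h, Fin.revPerm]⟩
  map_one' := by
    refine Subtype.ext (Equiv.ext fun i => ?_)
    obtain ⟨x, rfl⟩ := (blocks ht).surjective i
    rcases x with i | j | i <;> simp [Equiv.permCongr_apply, Fin.revPerm]
  map_mul' g h := by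
    refine Subtype.ext (Equiv.ext fun i => ?_)
    obtain ⟨x, rfl⟩ := (blocks ht).surjective i
    rcases x with i | j | i <;> simp [Equiv.permCongr_apply, Fin.revPerm]

/-- The box tensor product `V ⊠ U` of a representation of `G` and a representation of `H`: the
representation of `G × H` on `V ⊗ U` with `(g, h) (v ⊗ u) = g v ⊗ h u`. -/
noncomputable def box {G H V U : Type*} [Monoid G] [Monoid H] [AddCommGroup V] [Module ℂ V]
    [AddCommGroup U] [Module ℂ U] (ρ : Representation ℂ G V) (π : Representation ℂ H U) :
    Representation ℂ (G × H) (V ⊗[ℂ] U) :=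
  Representation.tprod (ρ.comp (MonoidHom.fst G H)) (π.comp (MonoidHom.snd G H))

/-- The element of the maximal subgroup `S_t ≅ W_{e_t}` of `RSp_{2n}` at `e_t` given by `s ∈ S_t`:
it acts on `{1, …, t}` as `s` and is undefined elsewhere. -/
def ofPerm {n t : ℕ} (ht : t ≤ n) (s : Equiv.Perm (Fin t)) : RSp n :=
  ofWSp n (embed ht (s, 1)) * idem ht

/-- The standard correspondence between irreducible representations `V` of `RSp_{2n}` and
irreducible representations `ψ` of its maximal subgroups, for the subgroup `S_t ≅ W_{e_t}`:
`V` is attached to `ψ` if `V` has apex `e_t`, i.e. the elements of rank less than `t` act by zero,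
and the action of the maximal subgroup at `e_t` on `e_t V` is isomorphic to `ψ`. -/
structure IsAttached {n t : ℕ} (ht : t ≤ n) {U V : Type*}
    [AddCommGroup U] [Module ℂ U] [AddCommGroup V] [Module ℂ V]
    (ψ : Representation ℂ (Equiv.Perm (Fin t)) U) (ρ : Representation ℂ (RSp n) V) : Prop where
  irreducible : ρ.IsIrreducible
  rank_lt : ∀ r : RSp n, rank r < t → ρ r = 0
  apex : ∃ f : U ≃ₗ[ℂ] LinearMap.range (ρ (idem ht)), ∀ (s : Equiv.Perm (Fin t)) (u : U),
    (f (ψ s u) : V) = ρ (ofPerm ht s) (f u)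

/-- `χ` is the character of an irreducible representation of `RSp_{2n}` attached to `ψ`. Every
finite-dimensional representation is isomorphic to one in the lowest universe. -/
def IsAttachedCharacter {n t : ℕ} (ht : t ≤ n) {U : Type*} [AddCommGroup U] [Module ℂ U]
    (ψ : Representation ℂ (Equiv.Perm (Fin t)) U) (χ : RSp n → ℂ) : Prop :=
  ∃ (V : Type) (_ : AddCommGroup V) (_ : Module ℂ V) (_ : FiniteDimensional ℂ V)
    (ρ : Representation ℂ (RSp n) V), IsAttached ht ψ ρ ∧ χ = ρ.character

end SymplecticRook

/-!
Irreducible representations of `RSp n` with apex `e_t`, and their restriction to the Weyl group.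

`RSp n` is a finite inverse monoid, with `star` the partial inverse. The elements `g` with
`star g * g = e_t` are the admissible injections of `{1, …, t}` into `{1, …, 2n}`; they form the
`L`-class of `e_t`, on which the maximal subgroup `S_t` acts freely from the right. The functions
on this `L`-class with values in `ψ` that are equivariant under `S_t` carry a representation of
`RSp n`, in which `m` translates by `star m` and gives zero at the injections whose range is not
contained in that of `m` (`schutzRep`).

This representation is irreducible: translating a nonzero function by some `star g` and then
applying `e_t` gives a nonzero function supported on `S_t`; these functions form a copy of `ψ`
(`delta`), and they generate everything, because the Weyl group is transitive on the admissible
injections (`exists_eq_ofWSp_mul_idem`, `sum_schutzRep_delta`). Any `V` attached to `ψ` maps to it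
by `v ↦ (g ↦ e_t-component of star g v)`. The map is equivariant because `star g * m` has rank less
than `t` unless the range of `g` lies in that of `m` (`rank_star_mul_lt`), and it is an isomorphism
by Schur's lemma (`IsAttached.nonempty_equiv`). So there is one character only.

As the stabilizer in the Weyl group of the set `{1, …, t}` is `S_t × W_{n-t}`
(`exists_eq_embed`), with `W_{n-t}` acting trivially on the functions supported on `S_t`, the
restriction to the Weyl group is the induced representation. The isomorphism is
`[h ⊗ u] ↦ h⁻¹ u`, and averaging over the Weyl group inverts it up to a nonzero scalar
(`indEquivSchutz`).
-/

open scoped TensorProduct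

namespace SymplecticRook

variable {n t : ℕ}

/-! ### The inverse monoid structure -/

theorem IsSymplectic.symm {f : Fin (2 * n) ≃. Fin (2 * n)} (hf : IsSymplectic f) :
    IsSymplectic f.symm := by
  rcases hf with ⟨w, hw, rfl⟩ | ⟨h1, h2⟩
  · exact Or.inl ⟨w⁻¹, inv_mem hw, rfl⟩
  · exact Or.inr ⟨h2, h1⟩

/-- The partial inverse of an element of `RSp n`, for which `RSp n` is an inverse monoid. -/
def star (r : RSp n) : RSp n := ⟨r.1.symm, r.2.symm⟩

instance (n : ℕ) : Finite (RSp n) := by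
  have h : Function.Injective fun (r : RSp n) (i : Fin (2 * n)) => r.1 i :=
    fun a b hab => Subtype.ext (PEquiv.ext fun i => congrFun hab i)
  exact Finite.of_injective _ h

theorem star_star (r : RSp n) : star (star r) = r := rfl

theorem star_mul (a b : RSp n) : star (a * b) = star b * star a :=
  Subtype.ext (PEquiv.symm_trans_rev b.1 a.1)

theorem star_ofWSp (w : WSp n) : star (ofWSp n w) = ofWSp n w⁻¹ := rfl

theorem ofWSp_inv_mul (w : WSp n) : ofWSp n w⁻¹ * ofWSp n w = 1 := by
  rw [← map_mul, inv_mul_cancel, map_one]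

theorem ofWSp_mul_inv (w : WSp n) : ofWSp n w * ofWSp n w⁻¹ = 1 := by
  rw [← map_mul, mul_inv_cancel, map_one]

theorem star_idem (ht : t ≤ n) : star (idem ht) = idem ht :=
  Subtype.ext (PEquiv.ofSet_symm _)

theorem mul_apply_eq_some (a b : RSp n) (i k : Fin (2 * n)) :
    (a * b).1 i = some k ↔ ∃ j, b.1 i = some j ∧ a.1 j = some k :=
  PEquiv.trans_eq_some b.1 a.1 i k

theorem ext_some {a b : RSp n} (h : ∀ i j, a.1 i = some j ↔ b.1 i = some j) : a = b :=
  Subtype.ext (PEquiv.ext fun i => Option.ext fun j => h i j)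

theorem star_apply_eq_some (a : RSp n) (i j : Fin (2 * n)) :
    (star a).1 i = some j ↔ a.1 j = some i :=
  PEquiv.eq_some_iff a.1

theorem star_mul_self_apply (r : RSp n) (i j : Fin (2 * n)) :
    (star r * r).1 i = some j ↔ i = j ∧ i ∈ dom r.1 := by
  simp only [mul_apply_eq_some, star_apply_eq_some]
  constructor
  · rintro ⟨k, h1, h2⟩
    exact ⟨r.1.inj h1 h2, Option.isSome_iff_exists.2 ⟨k, h1⟩⟩
  · rintro ⟨rfl, h⟩
    obtain ⟨k, hk⟩ := Option.isSome_iff_exists.1 h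
    exact ⟨k, hk, hk⟩

theorem mul_star_mul_self (r : RSp n) : r * (star r * r) = r := by
  refine ext_some fun i k => ?_
  rw [mul_apply_eq_some]
  simp only [star_mul_self_apply]
  constructor
  · rintro ⟨j, ⟨rfl, -⟩, h⟩; exact h
  · intro h; exact ⟨i, ⟨rfl, Option.isSome_iff_exists.2 ⟨k, h⟩⟩, h⟩

theorem commute_star_mul_self (a b : RSp n) : Commute (star a * a) (star b * b) := by
  refine ext_some fun i k => ?_
  simp only [mul_apply_eq_some (star a * a), mul_apply_eq_some (star b * b), star_mul_self_apply]
  constructor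
  · rintro ⟨j, ⟨rfl, h1⟩, rfl, h2⟩; exact ⟨i, ⟨rfl, h2⟩, rfl, h1⟩
  · rintro ⟨j, ⟨rfl, h1⟩, rfl, h2⟩; exact ⟨i, ⟨rfl, h2⟩, rfl, h1⟩

theorem idem_apply (ht : t ≤ n) (i j : Fin (2 * n)) :
    (idem ht).1 i = some j ↔ i = j ∧ i.val < t := by
  refine PEquiv.ofSet_eq_some_iff.trans ?_
  constructor
  · rintro ⟨rfl, h⟩; exact ⟨rfl, h⟩
  · rintro ⟨rfl, h⟩; exact ⟨rfl, h⟩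

theorem idem_mul_idem (ht : t ≤ n) : idem ht * idem ht = idem ht := by
  refine ext_some fun i k => ?_
  simp only [mul_apply_eq_some, idem_apply]
  constructor
  · rintro ⟨j, ⟨rfl, h1⟩, rfl, h2⟩; exact ⟨rfl, h1⟩
  · rintro ⟨rfl, h1⟩; exact ⟨i, ⟨rfl, h1⟩, rfl, h1⟩

/-! ### Ranks -/

theorem rank_mul_le_right (a b : RSp n) : rank (a * b) ≤ rank b :=
  Set.ncard_le_ncard (dom_trans_subset b.1 a.1) (Set.toFinite _)

theorem rank_star_le (a : RSp n) : rank (star a) ≤ rank a := by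
  refine Set.ncard_le_ncard_of_injOn (fun i => (a.1.symm i).getD i) ?_ ?_ (Set.toFinite _)
  · intro i hi
    obtain ⟨j, hj⟩ := Option.isSome_iff_exists.1 hi
    have hj' : a.1.symm i = some j := hj
    have : a.1 j = some i := (PEquiv.eq_some_iff a.1).1 hj'
    simp [hj', dom, this]
  · intro i hi i' hi' h
    obtain ⟨j, hj⟩ := Option.isSome_iff_exists.1 hi
    obtain ⟨j', hj'⟩ := Option.isSome_iff_exists.1 hi'
    have hj : a.1.symm i = some j := hj
    have hj' : a.1.symm i' = some j' := hj'
    simp only [hj, hj', Option.getD_some] at h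
    subst h
    exact a.1.symm.inj hj hj'

theorem rank_star (a : RSp n) : rank (star a) = rank a :=
  le_antisymm (rank_star_le a) (rank_star_le (star a))

theorem rank_mul_le_left (a b : RSp n) : rank (a * b) ≤ rank a := by
  rw [← rank_star, star_mul, ← rank_star a]
  exact rank_mul_le_right _ _

theorem dom_idem (ht : t ≤ n) : dom (idem ht).1 = {i | i.val < t} := by
  ext i
  refine Option.isSome_iff_exists.trans ?_
  simp [idem_apply]

theorem rank_idem (ht : t ≤ n) : rank (idem ht) = t := by
  rw [rank, dom_idem]
  have : {i : Fin (2 * n) | i.val < t} = Set.range (Fin.castLE (by omega : t ≤ 2 * n)) := by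
    ext i
    simp only [Set.mem_ofPred_eq, Set.mem_range]
    exact ⟨fun h => ⟨⟨i, h⟩, rfl⟩, by rintro ⟨j, rfl⟩; exact j.2⟩
  rw [this, Set.ncard_eq_toFinset_card', Set.toFinset_range,
    Finset.card_image_of_injective _ (Fin.castLE_injective _)]
  simp

theorem star_mul_self_eq_idem_of_le_rank (ht : t ≤ n) {x : RSp n} (hx : x * idem ht = x)
    (h : t ≤ rank x) : star x * x = idem ht := by
  have hs : dom x.1 ⊆ dom (idem ht).1 := by
    conv_lhs => rw [← hx]
    exact dom_trans_subset _ _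
  have hd : dom x.1 = dom (idem ht).1 :=
    Set.eq_of_subset_of_ncard_le hs (((rank_idem ht).trans_le h)) (Set.toFinite _)
  refine ext_some fun i j => ?_
  rw [star_mul_self_apply, hd, dom_idem, idem_apply]
  rfl

/-- If the range of the admissible injection `g` of `{1, …, t}` is not contained in the range
of `m`, then `star g * m` has rank less than `t`. -/
theorem rank_star_mul_lt (ht : t ≤ n) {g m : RSp n} (hg : star g * g = idem ht)
    (h : m * (star m * g) ≠ g) : rank (star g * m) < t := by
  by_contra! hr
  have hge : g * idem ht = g := by rw [← hg, mul_star_mul_self]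
  have h1 : star (star m * g) * (star m * g) = idem ht := by
    refine star_mul_self_eq_idem_of_le_rank ht (by rw [mul_assoc, hge]) ?_
    rwa [← rank_star, star_mul, star_star]
  refine h ?_
  rw [star_mul, star_star] at h1
  have h2 := (commute_star_mul_self (star m) (star g)).eq
  simp only [star_star] at h2
  calc m * (star m * g) = m * star m * (g * star g) * g := by
        rw [mul_assoc (m * star m), mul_assoc g, mul_star_mul_self, mul_assoc]
    _ = g * (star g * m * (star m * g)) := by rw [h2]; simp only [mul_assoc]
    _ = g := by rw [h1, hge]

theorem le_rank_of_fixes (ht : t ≤ n) {g m : RSp n} (hg : star g * g = idem ht)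
    (h : m * (star m * g) = g) : t ≤ rank m := by
  rw [← rank_idem ht, ← hg, ← h, ← mul_assoc _ m]
  refine (rank_mul_le_left _ _).trans ?_
  rw [h]
  exact rank_mul_le_right _ _

/-! ### Admissible injections of the first `t` points -/

theorem blocks_inl_val (ht : t ≤ n) (i : Fin t) : (blocks ht (.inl i)).val = i.val := by
  simp [blocks]

theorem eq_blocks_inl_iff (ht : t ≤ n) (x : Fin (2 * n)) :
    (∃ i, x = blocks ht (.inl i)) ↔ x.val < t := by
  constructor
  · rintro ⟨i, rfl⟩
    rw [blocks_inl_val]; exact i.2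
  · intro h
    exact ⟨⟨x, h⟩, Fin.ext (blocks_inl_val ht ⟨x, h⟩).symm⟩

theorem ofWSp_apply (w : WSp n) (i : Fin (2 * n)) : (ofWSp n w).1 i = some (w.1 i) := rfl

theorem ofWSp_mul_idem_apply (ht : t ≤ n) (w : WSp n) (x y : Fin (2 * n)) :
    (ofWSp n w * idem ht).1 x = some y ↔ x.val < t ∧ w.1 x = y := by
  simp only [mul_apply_eq_some, idem_apply, ofWSp_apply, Option.some.injEq]
  constructor
  · rintro ⟨j, ⟨rfl, h1⟩, h⟩; exact ⟨h1, h⟩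
  · rintro ⟨h1, h⟩; exact ⟨x, ⟨rfl, h1⟩, h⟩

theorem ofWSp_mul_idem_eq_iff (ht : t ≤ n) (v w : WSp n) :
    ofWSp n v * idem ht = ofWSp n w * idem ht ↔
      ∀ i : Fin t, v.1 (blocks ht (.inl i)) = w.1 (blocks ht (.inl i)) := by
  constructor
  · intro h i
    have hi := (eq_blocks_inl_iff ht _).1 ⟨i, rfl⟩
    have := (ofWSp_mul_idem_apply ht v _ _).2 ⟨hi, rfl⟩
    rw [h, ofWSp_mul_idem_apply] at this
    exact this.2.symm
  · intro h
    refine ext_some fun x y => ?_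
    rw [ofWSp_mul_idem_apply, ofWSp_mul_idem_apply]
    refine and_congr_right fun hx => ?_
    obtain ⟨i, rfl⟩ := (eq_blocks_inl_iff ht x).2 hx
    rw [h]

theorem embed_inl (ht : t ≤ n) (g : Equiv.Perm (Fin t) × WSp (n - t)) (i : Fin t) :
    (embed ht g).1 (blocks ht (.inl i)) = blocks ht (.inl (g.1 i)) := by
  simp [embed, Equiv.permCongr_apply]

theorem ofWSp_mul_idem_eq_ofPerm_iff (ht : t ≤ n) (w : WSp n) (s : Equiv.Perm (Fin t)) :
    ofWSp n w * idem ht = ofPerm ht s ↔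
      ∀ i : Fin t, w.1 (blocks ht (.inl i)) = blocks ht (.inl (s i)) := by
  rw [ofPerm, ofWSp_mul_idem_eq_iff]
  simp only [embed_inl]

theorem ofWSp_embed_mul_idem (ht : t ≤ n) (g : Equiv.Perm (Fin t) × WSp (n - t)) :
    ofWSp n (embed ht g) * idem ht = ofPerm ht g.1 := by
  rw [ofWSp_mul_idem_eq_ofPerm_iff]
  exact embed_inl ht g

theorem idem_mul_ofWSp_mul_idem_iff (ht : t ≤ n) (w : WSp n) :
    idem ht * (ofWSp n w * idem ht) = ofWSp n w * idem ht ↔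
      ∀ i : Fin t, ∃ j, w.1 (blocks ht (.inl i)) = blocks ht (.inl j) := by
  constructor
  · intro h i
    have hi := (eq_blocks_inl_iff ht _).1 ⟨i, rfl⟩
    have := (ofWSp_mul_idem_apply ht w _ _).2 ⟨hi, rfl⟩
    rw [← h, mul_apply_eq_some] at this
    obtain ⟨j, -, hj⟩ := this
    obtain ⟨rfl, hj⟩ := (idem_apply ht _ _).1 hj
    exact (eq_blocks_inl_iff ht _).2 hj
  · intro h
    refine ext_some fun x y => ?_
    rw [mul_apply_eq_some]
    simp only [ofWSp_mul_idem_apply, idem_apply]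
    constructor
    · rintro ⟨j, h1, rfl, h2⟩; exact h1
    · rintro ⟨h1, rfl⟩
      refine ⟨_, ⟨h1, rfl⟩, rfl, ?_⟩
      obtain ⟨i, rfl⟩ := (eq_blocks_inl_iff ht x).2 h1
      exact (eq_blocks_inl_iff ht _).1 (h i)

theorem ofPerm_mul_idem (ht : t ≤ n) (s : Equiv.Perm (Fin t)) :
    ofPerm ht s * idem ht = ofPerm ht s := by
  rw [ofPerm, mul_assoc, idem_mul_idem]

theorem idem_mul_ofPerm (ht : t ≤ n) (s : Equiv.Perm (Fin t)) :
    idem ht * ofPerm ht s = ofPerm ht s :=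
  (idem_mul_ofWSp_mul_idem_iff ht _).2 fun i => ⟨s i, embed_inl ht _ i⟩

theorem ofPerm_mul (ht : t ≤ n) (s s' : Equiv.Perm (Fin t)) :
    ofPerm ht (s * s') = ofPerm ht s * ofPerm ht s' := by
  conv_rhs => rw [ofPerm, mul_assoc, idem_mul_ofPerm, ofPerm, ← mul_assoc, ← map_mul, ← map_mul]
  rfl

theorem ofPerm_one (ht : t ≤ n) : ofPerm ht 1 = idem ht := by
  rw [ofPerm, show ((1 : Equiv.Perm (Fin t)), (1 : WSp (n - t))) = 1 from rfl, map_one, map_one,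
    one_mul]

theorem ofPerm_injective (ht : t ≤ n) : Function.Injective (ofPerm ht) := by
  intro s s' h
  ext i
  have := (ofWSp_mul_idem_eq_iff ht _ _).1 h i
  rw [embed_inl, embed_inl, (blocks ht).injective.eq_iff, Sum.inl_injective.eq_iff] at this
  exact congrArg Fin.val this

theorem star_mul_self_ofWSp_mul_idem (ht : t ≤ n) (w : WSp n) :
    star (ofWSp n w * idem ht) * (ofWSp n w * idem ht) = idem ht := by
  rw [star_mul, star_ofWSp, star_idem, mul_assoc, ← mul_assoc _ _ (idem ht), ofWSp_inv_mul,
    one_mul, idem_mul_idem]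

/-- Any admissible injection of the first `t` points extends to an element of the Weyl group:
both the choice of a pair `{i, bar i}` and the choice of a point in that pair can be extended
arbitrarily to the remaining pairs. -/
theorem exists_wSp_extending (ht : t ≤ n) (a : Fin t → Fin (2 * n)) (ha : Function.Injective a)
    (ha' : ∀ i j, Fin.rev (a i) ≠ a j) :
    ∃ w : WSp n, ∀ i, w.1 (blocks ht (.inl i)) = a i := by
  let pos : Fin n × Bool → Fin (2 * n) := fun p =>
    if p.2 then Fin.rev (Fin.castLE (by omega) p.1) else Fin.castLE (by omega) p.1
  have hpos : Function.Bijective pos := by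
    rw [Fintype.bijective_iff_injective_and_card]
    refine ⟨?_, by simp [mul_comm]⟩
    rintro ⟨k, b⟩ ⟨k', b'⟩ h
    have hk := k.2
    have hk' := k'.2
    have h := congrArg Fin.val h
    cases b <;> cases b' <;> simp [pos] at h ⊢ <;> omega
  have hrev : ∀ p, pos (p.1, !p.2) = Fin.rev (pos p) := by
    rintro ⟨k, b⟩
    cases b <;> simp [pos]
  let E := Equiv.ofBijective pos hpos
  let α : Fin t → Fin n := fun i => (E.symm (a i)).1
  let β : Fin t → Bool := fun i => (E.symm (a i)).2
  have hab : ∀ i, pos (α i, β i) = a i := fun i => E.apply_symm_apply (a i)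
  have hα : Function.Injective α := by
    intro i j hij
    by_cases hb : β i = β j
    · exact ha (by rw [← hab, ← hab, hij, hb])
    · refine absurd ?_ (ha' i j)
      rw [← hab, ← hab, ← hrev, hij]
      congr 2
      cases h1 : β i <;> cases h2 : β j <;> simp_all
  have hpre := Equiv.Perm.isMultiplyPretransitive (Fin n) t
  obtain ⟨π, hπ⟩ := MulAction.exists_smul_eq (M := Equiv.Perm (Fin n)) (Fin.castLEEmb ht)
    (⟨α, hα⟩ : Fin t ↪ Fin n)
  have hπ' : ∀ i, π (Fin.castLE ht i) = α i := fun i => DFunLike.congr_fun hπ i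
  let γ : Fin n → Bool := fun k => if h : k.val < t then β ⟨k, h⟩ else false
  let σ : Equiv.Perm (Fin n × Bool) :=
    { toFun := fun p => (π p.1, xor p.2 (γ p.1))
      invFun := fun p => (π.symm p.1, xor p.2 (γ (π.symm p.1)))
      left_inv := fun p => by simp
      right_inv := fun p => by simp }
  have hw : ∀ p, E.permCongr σ (pos p) = pos (σ p) := fun p => by
    rw [Equiv.permCongr_apply]
    have h1 : E.symm (pos p) = p := E.symm_apply_apply p
    rw [h1]
    rfl
  refine ⟨⟨E.permCongr σ, (admissible_image_iff _).2 fun x => ?_⟩, fun i => ?_⟩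
  · obtain ⟨p, rfl⟩ := hpos.2 x
    rw [← hrev, hw, hw, ← hrev]
    simp [σ]
  · have h1 : blocks ht (.inl i) = pos (Fin.castLE ht i, false) :=
      Fin.ext (by simp [blocks_inl_val, pos])
    change E.permCongr σ _ = _
    rw [h1, hw, ← hab]
    simp [σ, hπ', γ]

theorem exists_eq_ofWSp_mul_idem (ht : t ≤ n) {g : RSp n} (hg : star g * g = idem ht) :
    ∃ w, g = ofWSp n w * idem ht := by
  rcases g.2 with ⟨w, hw, h⟩ | ⟨-, h2⟩
  · -- A unit `g` has `e_t = star g * g = 1`; this happens only for `n = 0`.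
    refine ⟨⟨w, hw⟩, ?_⟩
    have hgw : g = ofWSp n ⟨w, hw⟩ := Subtype.ext h
    rw [← hgw, ← hg, mul_star_mul_self]
  · have hdom : ∀ i : Fin t, ∃ y, g.1 (blocks ht (.inl i)) = some y := fun i => by
      have hi : (idem ht).1 (blocks ht (.inl i)) = some (blocks ht (.inl i)) :=
        (idem_apply ht _ _).2 ⟨rfl, (eq_blocks_inl_iff ht _).1 ⟨i, rfl⟩⟩
      rw [← hg, star_mul_self_apply] at hi
      exact Option.isSome_iff_exists.1 hi.2
    choose a ha using hdom
    have hran : ∀ i, a i ∈ dom g.1.symm := fun i =>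
      Option.isSome_iff_exists.2 ⟨_, (PEquiv.eq_some_iff g.1).2 (ha i)⟩
    obtain ⟨w, hw⟩ := exists_wSp_extending ht a
      (fun i j hij => Sum.inl_injective ((blocks ht).injective
        (g.1.inj (ha i) (hij ▸ ha j))))
      (fun i j hij => h2.2.elim (fun h => h2.1 h) fun h => h _ (hran i) (hij ▸ hran j))
    refine ⟨w, ext_some fun x y => ?_⟩
    rw [ofWSp_mul_idem_apply]
    constructor
    · intro hxy
      have hx : (star g * g).1 x = some x :=
        (star_mul_self_apply g x x).2 ⟨rfl, Option.isSome_iff_exists.2 ⟨y, hxy⟩⟩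
      rw [hg, idem_apply] at hx
      obtain ⟨i, rfl⟩ := (eq_blocks_inl_iff ht x).2 hx.2
      refine ⟨hx.2, ?_⟩
      rw [hw]
      exact Option.some.inj ((ha i).symm.trans hxy)
    · rintro ⟨hx, rfl⟩
      obtain ⟨i, rfl⟩ := (eq_blocks_inl_iff ht x).2 hx
      rw [hw, ha]

theorem mul_idem_eq_self (ht : t ≤ n) {g : RSp n} (hg : star g * g = idem ht) :
    g * idem ht = g := by
  rw [← hg, mul_star_mul_self]

/-- An element of the `L`-class of `e_t` with range inside `{1, …, t}` lies in the maximal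
subgroup, since the symmetric group consists of all injections of a finite set into itself. -/
theorem exists_eq_ofPerm (ht : t ≤ n) {g : RSp n} (hg : star g * g = idem ht)
    (hg' : idem ht * g = g) : ∃ s, g = ofPerm ht s := by
  obtain ⟨w, rfl⟩ := exists_eq_ofWSp_mul_idem ht hg
  choose s hs using (idem_mul_ofWSp_mul_idem_iff ht w).1 hg'
  have hinj : Function.Injective s := fun i j hij => by
    have h := hs i
    rw [hij, ← hs j] at h
    exact Sum.inl_injective ((blocks ht).injective (w.1.injective h))
  exact ⟨Equiv.ofBijective s (Finite.injective_iff_bijective.1 hinj),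
    (ofWSp_mul_idem_eq_ofPerm_iff ht w _).2 hs⟩

/-- The elements of the Weyl group acting on `{1, …, t}` as a permutation form the subgroup
`S_t × W_{n-t}`: such an element preserves the outer blocks, hence the middle one. -/
theorem exists_eq_embed (ht : t ≤ n) {w : WSp n} {s : Equiv.Perm (Fin t)}
    (h : ofWSp n w * idem ht = ofPerm ht s) : ∃ w', w = embed ht (s, w') := by
  rw [ofWSp_mul_idem_eq_ofPerm_iff] at h
  have hw := (admissible_image_iff _).1 w.2
  have h3 : ∀ i : Fin t, w.1 (blocks ht (.inr (.inr i))) =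
      blocks ht (.inr (.inr (Fin.rev (s (Fin.rev i))))) := fun i => by
    have h1 := rev_blocks ht (.inl (Fin.rev i))
    simp only [Fin.rev_rev] at h1
    rw [← h1, hw, h, rev_blocks]
  have h2 : ∀ j : Fin (2 * (n - t)), ∃ k, w.1 (blocks ht (.inr (.inl j))) =
      blocks ht (.inr (.inl k)) := fun j => by
    obtain ⟨x, hx⟩ := (blocks ht).surjective (w.1 (blocks ht (.inr (.inl j))))
    rcases x with i | k | i
    · rw [← s.apply_symm_apply i, ← h] at hx
      have := (blocks ht).injective (w.1.injective hx)
      simp at this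
    · exact ⟨k, hx.symm⟩
    · have h4 := h3 (Fin.rev (s.symm (Fin.rev i)))
      rw [Fin.rev_rev, s.apply_symm_apply, Fin.rev_rev, hx] at h4
      have := (blocks ht).injective (w.1.injective h4)
      simp at this
  choose f hf using h2
  have hinj : Function.Injective f := fun i j hij => by
    have h4 := hf i
    rw [hij, ← hf j] at h4
    simpa using (blocks ht).injective (w.1.injective h4)
  refine ⟨⟨Equiv.ofBijective f (Finite.injective_iff_bijective.1 hinj),
    (admissible_image_iff _).2 fun j => ?_⟩, ?_⟩
  · change f _ = Fin.rev (f j)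
    have h4 := hf (Fin.rev j)
    have h5 := rev_blocks ht (.inr (.inl j))
    rw [← h5, hw, hf, rev_blocks] at h4
    simpa using ((blocks ht).injective h4).symm
  · refine Subtype.ext (Equiv.ext fun x => ?_)
    obtain ⟨x, rfl⟩ := (blocks ht).surjective x
    rcases x with i | j | i
    · rw [h, embed_inl]
    · rw [hf]
      simp [embed, Equiv.permCongr_apply]
    · rw [h3]
      simp [embed, Equiv.permCongr_apply, Fin.revPerm]

theorem star_ofPerm (ht : t ≤ n) (s : Equiv.Perm (Fin t)) :
    star (ofPerm ht s) = ofPerm ht s⁻¹ := by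
  have h := star_mul_self_ofWSp_mul_idem ht (embed ht (s, 1))
  change star (ofPerm ht s) * ofPerm ht s = _ at h
  have h1 : star (ofPerm ht s) * idem ht = star (ofPerm ht s) := by
    rw [← star_idem, ← star_mul, idem_mul_ofPerm]
  rw [← h1, ← ofPerm_one, ← mul_inv_cancel s, ofPerm_mul, ← mul_assoc, h, idem_mul_ofPerm]

/-! ### The representation induced from the maximal subgroup -/

open scoped Classical in
noncomputable instance (n : ℕ) : Fintype (WSp n) := Fintype.ofFinite _

section

variable {U : Type*} [AddCommGroup U] [Module ℂ U]

/-- The space of `S_t`-equivariant functions on the `L`-class `{g | star g * g = e_t}` with values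
in the representation space of `ψ`, extended by zero to functions on all of `RSp n`. -/
def schutzSpace (ht : t ≤ n) (ψ : Representation ℂ (Equiv.Perm (Fin t)) U) :
    Submodule ℂ (RSp n → U) where
  carrier := {f | (∀ g, star g * g ≠ idem ht → f g = 0) ∧
    ∀ g s, star g * g = idem ht → f (g * ofPerm ht s) = ψ s⁻¹ (f g)}
  add_mem' := fun {f f'} h h' => ⟨fun g hg => by simp [h.1 g hg, h'.1 g hg],
    fun g s hg => by simp [h.2 g s hg, h'.2 g s hg]⟩
  zero_mem' := ⟨fun _ _ => rfl, fun _ _ _ => by simp⟩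
  smul_mem' := fun c f h => ⟨fun g hg => by simp [h.1 g hg], fun g s hg => by simp [h.2 g s hg]⟩

theorem star_mul_self_mul_ofPerm (ht : t ≤ n) {g : RSp n} (hg : star g * g = idem ht)
    (s : Equiv.Perm (Fin t)) :
    star (g * ofPerm ht s) * (g * ofPerm ht s) = idem ht := by
  rw [star_mul, mul_assoc, ← mul_assoc (star g), hg, idem_mul_ofPerm]
  exact star_mul_self_ofWSp_mul_idem ht _

theorem star_mul_self_ofPerm (ht : t ≤ n) (s : Equiv.Perm (Fin t)) :
    star (ofPerm ht s) * ofPerm ht s = idem ht :=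
  star_mul_self_ofWSp_mul_idem ht _

theorem mul_ofPerm_cancel (ht : t ≤ n) {g : RSp n} (hg : star g * g = idem ht)
    (s : Equiv.Perm (Fin t)) : g * ofPerm ht s * ofPerm ht s⁻¹ = g := by
  rw [mul_assoc, ← ofPerm_mul, mul_inv_cancel, ofPerm_one, mul_idem_eq_self ht hg]

theorem star_mul_self_of_fixes {g m : RSp n} (h : m * (star m * g) = g) :
    star (star m * g) * (star m * g) = star g * g := by
  rw [star_mul, star_star, mul_assoc, h]

theorem fixes_mul_ofPerm_iff (ht : t ≤ n) {g : RSp n} (hg : star g * g = idem ht) (m : RSp n)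
    (s : Equiv.Perm (Fin t)) :
    m * (star m * (g * ofPerm ht s)) = g * ofPerm ht s ↔ m * (star m * g) = g := by
  constructor
  · intro h
    rw [← mul_ofPerm_cancel ht hg s]
    conv_rhs => rw [← h]
    simp only [mul_assoc]
  · intro h
    conv_rhs => rw [← h]
    simp only [mul_assoc]

/-- The range of `g` lies in that of `a * b` iff it lies in the range of `a` and the range of
`star a * g` lies in that of `b`. -/
theorem fixes_mul_iff (a b g : RSp n) :
    a * b * (star (a * b) * g) = g ↔
      a * (star a * g) = g ∧ b * (star b * (star a * g)) = star a * g := by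
  have hc := (commute_star_mul_self a (star b)).eq
  have hc' := (commute_star_mul_self (star a) (star (a * b))).eq
  simp only [star_star] at hc hc'
  rw [star_mul] at *
  constructor
  · intro h
    have h1 : a * (star a * g) = g := by
      conv_rhs => rw [← h]
      conv_lhs => rw [← h]
      have := mul_star_mul_self a
      calc a * (star a * (a * b * (star b * star a * g)))
          = a * (star a * a) * (b * (star b * star a * g)) := by simp only [mul_assoc]
        _ = _ := by rw [this]; simp only [mul_assoc]
    refine ⟨h1, ?_⟩
    conv_rhs => rw [← h]
    calc b * (star b * (star a * g))
        = b * star b * (star a * g) := by simp only [mul_assoc]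
      _ = b * star b * (star a * (a * (star a * g))) := by rw [h1]
      _ = b * star b * (star a * a) * (star a * g) := by simp only [mul_assoc]
      _ = star a * (a * b * (star b * star a * g)) := by rw [← hc]; simp only [mul_assoc]
  · rintro ⟨h1, h2⟩
    rw [mul_assoc, mul_assoc (star b), h2, h1]

open scoped Classical in
/-- The (dual) Schützenberger representation of `RSp n` attached to `ψ`: an element `m` acts by
translation by `star m` on the functions on the `L`-class of `e_t`, the value being zero at the
points `g` whose range is not contained in the range of `m`. -/
noncomputable def schutzRep (ht : t ≤ n) (ψ : Representation ℂ (Equiv.Perm (Fin t)) U) :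
    Representation ℂ (RSp n) (schutzSpace ht ψ) where
  toFun m :=
    { toFun := fun f => ⟨fun g => if m * (star m * g) = g then f.1 (star m * g) else 0, by
        constructor
        · intro g hg
          beta_reduce
          split_ifs with h
          · exact f.2.1 _ (by rwa [star_mul_self_of_fixes h])
          · rfl
        · intro g s hg
          simp only [fixes_mul_ofPerm_iff ht hg m s]
          split_ifs with h
          · rw [← mul_assoc, f.2.2 _ _ (by rwa [star_mul_self_of_fixes h])]
          · simp⟩
      map_add' := fun f f' => Subtype.ext (funext fun g => by
        by_cases h : m * (star m * g) = g <;> simp [h])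
      map_smul' := fun c f => Subtype.ext (funext fun g => by
        by_cases h : m * (star m * g) = g <;> simp [h]) }
  map_one' := LinearMap.ext fun f => Subtype.ext (funext fun g => by
    have h : star (1 : RSp n) = 1 := rfl
    simp [h])
  map_mul' a b := LinearMap.ext fun f => Subtype.ext (funext fun g => by
    change (if a * b * (star (a * b) * g) = g then f.1 (star (a * b) * g) else 0) =
      if a * (star a * g) = g then
        (if b * (star b * (star a * g)) = star a * g then f.1 (star b * (star a * g)) else 0)
      else 0
    have h := fixes_mul_iff a b g
    rw [star_mul, mul_assoc (star b)] at h
    rw [← ite_and, star_mul, mul_assoc (star b)]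
    exact if_congr h rfl rfl)

variable {ht : t ≤ n} {ψ : Representation ℂ (Equiv.Perm (Fin t)) U}

theorem schutzRep_apply_of_fixes (f : schutzSpace ht ψ) {m g : RSp n}
    (h : m * (star m * g) = g) : (schutzRep ht ψ m f).1 g = f.1 (star m * g) := if_pos h

theorem schutzRep_apply_of_not_fixes (f : schutzSpace ht ψ) {m g : RSp n}
    (h : m * (star m * g) ≠ g) : (schutzRep ht ψ m f).1 g = 0 := if_neg h

theorem schutzRep_ofWSp_apply (f : schutzSpace ht ψ) (w : WSp n) (g : RSp n) :
    (schutzRep ht ψ (ofWSp n w) f).1 g = f.1 (ofWSp n w⁻¹ * g) :=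
  schutzRep_apply_of_fixes f (by rw [star_ofWSp, ← mul_assoc, ofWSp_mul_inv, one_mul])

theorem apply_ofPerm (f : schutzSpace ht ψ) (s : Equiv.Perm (Fin t)) :
    f.1 (ofPerm ht s) = ψ s⁻¹ (f.1 (idem ht)) := by
  rw [← idem_mul_ofPerm, f.2.2]
  rw [star_idem, idem_mul_idem]

theorem apply_eq_zero (f : schutzSpace ht ψ) {g : RSp n} (hg : star g * g ≠ idem ht) :
    f.1 g = 0 := f.2.1 g hg

open scoped Classical in
theorem sum_ofPerm_apply (ht : t ≤ n) (ψ : Representation ℂ (Equiv.Perm (Fin t)) U) (u : U)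
    (s : Equiv.Perm (Fin t)) :
    (∑ r, if ofPerm ht r = ofPerm ht s then ψ r⁻¹ u else 0) = ψ s⁻¹ u := by
  simp [(ofPerm_injective ht).eq_iff]

open scoped Classical in
/-- The embedding of the representation space of `ψ` into the Schützenberger representation, as
the functions supported on the maximal subgroup at `e_t`. -/
noncomputable def delta (ht : t ≤ n) (ψ : Representation ℂ (Equiv.Perm (Fin t)) U) :
    U →ₗ[ℂ] schutzSpace ht ψ where
  toFun u := ⟨fun g => ∑ r, if ofPerm ht r = g then ψ r⁻¹ u else 0, by
    constructor
    · intro g hg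
      refine Finset.sum_eq_zero fun r _ => if_neg ?_
      rintro rfl
      exact hg (star_mul_self_ofPerm ht r)
    · intro g s hg
      by_cases h : ∃ r, ofPerm ht r = g
      · obtain ⟨r, rfl⟩ := h
        simp only [← ofPerm_mul, sum_ofPerm_apply]
        simp
      · beta_reduce
        rw [Finset.sum_eq_zero (f := fun r => if ofPerm ht r = g then ψ r⁻¹ u else 0)
          fun r _ => if_neg fun h' => h ⟨r, h'⟩, map_zero]
        refine Finset.sum_eq_zero fun r _ => if_neg fun h' => h ⟨r * s⁻¹, ?_⟩
        rw [ofPerm_mul, h', mul_ofPerm_cancel ht hg]⟩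
  map_add' u v := Subtype.ext (funext fun g => by
    simp only [map_add, Submodule.coe_add, Pi.add_apply, ← Finset.sum_add_distrib]
    exact Finset.sum_congr rfl fun r _ => by split_ifs <;> simp)
  map_smul' c u := Subtype.ext (funext fun g => by
    simp [Finset.smul_sum])

theorem delta_apply_ofPerm (u : U) (s : Equiv.Perm (Fin t)) :
    (delta ht ψ u).1 (ofPerm ht s) = ψ s⁻¹ u := sum_ofPerm_apply ht ψ u s

theorem delta_apply_of_ne (u : U) {g : RSp n} (h : ∀ s, ofPerm ht s ≠ g) :
    (delta ht ψ u).1 g = 0 := Finset.sum_eq_zero fun r _ => if_neg (h r)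

theorem delta_apply_idem (u : U) : (delta ht ψ u).1 (idem ht) = u := by
  rw [← ofPerm_one, delta_apply_ofPerm]
  simp

theorem delta_injective : Function.Injective (delta ht ψ) := fun u v h => by
  rw [← delta_apply_idem (ht := ht) (ψ := ψ) u, h, delta_apply_idem]

theorem schutzRep_idem (f : schutzSpace ht ψ) :
    schutzRep ht ψ (idem ht) f = delta ht ψ (f.1 (idem ht)) := by
  refine Subtype.ext (funext fun g => ?_)
  by_cases hg : star g * g = idem ht
  · by_cases he : idem ht * g = g
    · obtain ⟨s, rfl⟩ := exists_eq_ofPerm ht hg he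
      rw [schutzRep_apply_of_fixes f (by rw [star_idem, he, he]), star_idem, he, apply_ofPerm,
        delta_apply_ofPerm]
    · rw [schutzRep_apply_of_not_fixes f, delta_apply_of_ne]
      · rintro s rfl
        exact he (idem_mul_ofPerm ht s)
      · rwa [star_idem, ← mul_assoc, idem_mul_idem]
  · rw [apply_eq_zero _ hg, apply_eq_zero _ hg]

theorem schutzRep_embed_delta (g : Equiv.Perm (Fin t) × WSp (n - t)) (u : U) :
    schutzRep ht ψ (ofWSp n (embed ht g)) (delta ht ψ u) = delta ht ψ (ψ g.1 u) := by
  have key : ∀ (g : Equiv.Perm (Fin t) × WSp (n - t)) r,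
      ofWSp n (embed ht g) * ofPerm ht r = ofPerm ht (g.1 * r) := fun g r => by
    rw [ofPerm_mul, ← ofWSp_embed_mul_idem, mul_assoc, idem_mul_ofPerm]
  refine Subtype.ext (funext fun x => ?_)
  rw [schutzRep_ofWSp_apply]
  by_cases hx : ∃ r, ofPerm ht r = x
  · obtain ⟨r, rfl⟩ := hx
    rw [← map_inv, key, delta_apply_ofPerm, delta_apply_ofPerm]
    simp
  · rw [delta_apply_of_ne _ fun s hs => hx ⟨s, hs⟩, delta_apply_of_ne]
    rintro s hs
    refine hx ⟨g.1 * s, ?_⟩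
    rw [← key, hs, ← mul_assoc, ofWSp_mul_inv, one_mul]

theorem schutzRep_ofPerm_delta (s : Equiv.Perm (Fin t)) (u : U) :
    schutzRep ht ψ (ofPerm ht s) (delta ht ψ u) = delta ht ψ (ψ s u) := by
  rw [ofPerm, map_mul, Module.End.mul_apply, schutzRep_idem, delta_apply_idem,
    schutzRep_embed_delta]

open scoped Classical in
/-- The number of elements of the Weyl group that act on `{1, …, t}` as a permutation, as a
complex number. -/
noncomputable def stabCard (ht : t ≤ n) : ℂ :=
  ∑ w : WSp n, if ∃ s, ofWSp n w * idem ht = ofPerm ht s then 1 else 0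

theorem stabCard_ne_zero (ht : t ≤ n) : stabCard ht ≠ 0 := by
  classical
  rw [stabCard, Finset.sum_boole, Nat.cast_ne_zero, Finset.card_ne_zero]
  refine ⟨1, Finset.mem_filter.2 ⟨Finset.mem_univ _, 1, ?_⟩⟩
  rw [map_one, one_mul, ofPerm_one]

/-- Every function in the Schützenberger representation is an average of translates, under the
Weyl group, of functions supported on the maximal subgroup. -/
theorem sum_schutzRep_delta (f : schutzSpace ht ψ) :
    ∑ w : WSp n, schutzRep ht ψ (ofWSp n w) (delta ht ψ (f.1 (ofWSp n w * idem ht))) =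
      stabCard ht • f := by
  classical
  refine Subtype.ext (funext fun h => ?_)
  by_cases hh : star h * h = idem ht
  · obtain ⟨v, rfl⟩ := exists_eq_ofWSp_mul_idem ht hh
    have hterm : ∀ w : WSp n, (schutzRep ht ψ (ofWSp n w)
        (delta ht ψ (f.1 (ofWSp n w * idem ht)))).1 (ofWSp n v * idem ht) =
        (if ∃ s, ofWSp n (w⁻¹ * v) * idem ht = ofPerm ht s then (1 : ℂ) else 0) •
          f.1 (ofWSp n v * idem ht) := fun w => by
      rw [schutzRep_ofWSp_apply, ← mul_assoc, ← map_mul]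
      split_ifs with hs
      · obtain ⟨s, hs⟩ := hs
        rw [hs, delta_apply_ofPerm, ← f.2.2 _ _ (star_mul_self_ofWSp_mul_idem ht w), mul_assoc,
          idem_mul_ofPerm, ← hs, ← mul_assoc, ← map_mul, mul_inv_cancel_left, one_smul]
      · rw [zero_smul, delta_apply_of_ne]
        exact fun s hs' => hs ⟨s, hs'.symm⟩
    have hsum : ∑ w : WSp n, (if ∃ s, ofWSp n (w⁻¹ * v) * idem ht = ofPerm ht s
        then (1 : ℂ) else 0) = stabCard ht :=
      Fintype.sum_equiv ((Equiv.inv _).trans (Equiv.mulRight v)) _ _ fun w => rfl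
    rw [AddSubmonoidClass.coe_finsetSum, Finset.sum_apply, Finset.sum_congr rfl fun w _ => hterm w,
      ← Finset.sum_smul, hsum]
    rfl
  · rw [apply_eq_zero _ hh, apply_eq_zero _ hh]

theorem eq_top_of_delta_mem (Y : Subrepresentation (schutzRep ht ψ))
    (h : ∀ u, delta ht ψ u ∈ Y.toSubmodule) : Y.toSubmodule = ⊤ := by
  refine eq_top_iff.2 fun f _ => ?_
  rw [← inv_smul_smul₀ (stabCard_ne_zero ht) f, ← sum_schutzRep_delta]
  exact Y.toSubmodule.smul_mem _ (Y.toSubmodule.sum_mem fun w _ =>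
    Y.apply_mem_toSubmodule _ (h _))

end

/-! ### The Schützenberger representation is attached -/

section

variable {U : Type*} [AddCommGroup U] [Module ℂ U] {ht : t ≤ n}
  {ψ : Representation ℂ (Equiv.Perm (Fin t)) U}

/-- A nontrivial representation is irreducible if every invariant subspace containing a nonzero
vector is everything. -/
theorem isIrreducible_of_forall {G V : Type*} [Monoid G] [AddCommGroup V] [Module ℂ V]
    {ρ : Representation ℂ G V} [Nontrivial V]
    (h : ∀ (Y : Subrepresentation ρ) (v : V), v ∈ Y.toSubmodule → v ≠ 0 → Y.toSubmodule = ⊤) :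
    ρ.IsIrreducible where
  exists_pair_ne := ⟨⊥, ⊤, fun hbt => by
    obtain ⟨v, hv⟩ := exists_ne (0 : V)
    have h1 : v ∈ (⊤ : Subrepresentation ρ).toSubmodule := Submodule.mem_top
    rw [← hbt] at h1
    exact hv ((Submodule.mem_bot ℂ).1 h1)⟩
  eq_bot_or_eq_top Y := by
    by_cases hY : ∃ v ∈ Y.toSubmodule, v ≠ 0
    · obtain ⟨v, hv, hv0⟩ := hY
      exact Or.inr (Subrepresentation.toSubmodule_injective (h Y v hv hv0))
    · push Not at hY
      exact Or.inl (Subrepresentation.toSubmodule_injective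
        (eq_bot_iff.2 fun v hv => (Submodule.mem_bot ℂ).2 (hY v hv)))

theorem nontrivial_of_isIrreducible {G V : Type*} [Monoid G] [AddCommGroup V] [Module ℂ V]
    {ρ : Representation ℂ G V} (h : ρ.IsIrreducible) : Nontrivial V := by
  by_contra hV
  rw [not_nontrivial_iff_subsingleton] at hV
  obtain ⟨Y, Y', hne⟩ := h.exists_pair_ne
  exact hne (Subrepresentation.toSubmodule_injective (Subsingleton.elim _ _))

theorem eq_top_of_isIrreducible {G V : Type*} [Monoid G] [AddCommGroup V] [Module ℂ V]
    {ρ : Representation ℂ G V} (h : ρ.IsIrreducible) (Y : Subrepresentation ρ) {v : V}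
    (hv : v ∈ Y.toSubmodule) (hv0 : v ≠ 0) : Y.toSubmodule = ⊤ := by
  rcases h.eq_bot_or_eq_top Y with rfl | rfl
  · exact absurd ((Submodule.mem_bot ℂ).1 hv) hv0
  · rfl

theorem schutzRep_isIrreducible (hψ : ψ.IsIrreducible) : (schutzRep ht ψ).IsIrreducible := by
  have := nontrivial_of_isIrreducible hψ
  have : Nontrivial (schutzSpace ht ψ) := delta_injective.nontrivial
  refine isIrreducible_of_forall fun Y f hf hf0 => eq_top_of_delta_mem Y ?_
  obtain ⟨g, hg⟩ : ∃ g, f.1 g ≠ 0 := by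
    by_contra! h
    exact hf0 (Subtype.ext (funext h))
  have hgL : star g * g = idem ht := by
    by_contra h
    exact hg (apply_eq_zero f h)
  -- Translating `f` by `star g` moves its value at `g` to `e_t`.
  have h1 : (schutzRep ht ψ (star g) f).1 (idem ht) = f.1 g := by
    rw [schutzRep_apply_of_fixes, star_star, mul_idem_eq_self ht hgL]
    rw [star_star, mul_idem_eq_self ht hgL, hgL]
  have h2 : delta ht ψ (f.1 g) ∈ Y.toSubmodule := by
    rw [← h1, ← schutzRep_idem]
    exact Y.apply_mem_toSubmodule _ (Y.apply_mem_toSubmodule _ hf)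
  let Z : Subrepresentation ψ := ⟨Y.toSubmodule.comap (delta ht ψ), fun s u hu => by
    rw [Submodule.mem_comap, ← schutzRep_ofPerm_delta]
    exact Y.apply_mem_toSubmodule _ hu⟩
  have hZ := eq_top_of_isIrreducible hψ Z h2 hg
  intro u
  have : u ∈ Z.toSubmodule := hZ ▸ Submodule.mem_top
  exact this

theorem schutzRep_isAttached (hψ : ψ.IsIrreducible) : IsAttached ht ψ (schutzRep ht ψ) where
  irreducible := schutzRep_isIrreducible hψ
  rank_lt r hr := LinearMap.ext fun f => Subtype.ext (funext fun g => by
    by_cases hg : star g * g = idem ht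
    · exact schutzRep_apply_of_not_fixes f fun h => (le_rank_of_fixes ht hg h).not_gt hr
    · exact apply_eq_zero _ hg)
  apex := by
    have hmem : ∀ u, delta ht ψ u ∈ LinearMap.range (schutzRep ht ψ (idem ht)) := fun u =>
      ⟨delta ht ψ u, by rw [schutzRep_idem, delta_apply_idem]⟩
    refine ⟨LinearEquiv.ofBijective ((delta ht ψ).codRestrict _ hmem) ⟨?_, ?_⟩, fun s u => ?_⟩
    · intro u v h
      exact delta_injective (congrArg Subtype.val h)
    · rintro ⟨_, f, rfl⟩
      exact ⟨f.1 (idem ht), Subtype.ext (schutzRep_idem f).symm⟩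
    · exact (schutzRep_ofPerm_delta s u).symm

/-! ### Uniqueness -/

variable {V : Type*} [AddCommGroup V] [Module ℂ V] {ρ : Representation ℂ (RSp n) V}

open scoped Classical in
/-- A linear map `A : V → U` that intertwines the actions of the maximal subgroup at `e_t` sends
each vector `v` to the function `g ↦ A (star g v)`, an element of the Schützenberger
representation. -/
noncomputable def toSchutz (ht : t ≤ n) (ψ : Representation ℂ (Equiv.Perm (Fin t)) U)
    (ρ : Representation ℂ (RSp n) V) (A : V →ₗ[ℂ] U)
    (hA : ∀ s v, A (ρ (ofPerm ht s) v) = ψ s (A v)) : V →ₗ[ℂ] schutzSpace ht ψ where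
  toFun v := ⟨fun g => if star g * g = idem ht then A (ρ (star g) v) else 0, by
    refine ⟨fun g hg => if_neg hg, fun g s hg => ?_⟩
    beta_reduce
    rw [if_pos hg, if_pos (star_mul_self_mul_ofPerm ht hg s), star_mul, star_ofPerm, map_mul,
      Module.End.mul_apply, hA]⟩
  map_add' v v' := Subtype.ext (funext fun g => by
    by_cases h : star g * g = idem ht <;> simp [h])
  map_smul' c v := Subtype.ext (funext fun g => by
    by_cases h : star g * g = idem ht <;> simp [h])

theorem toSchutz_apply {A : V →ₗ[ℂ] U} (hA : ∀ s v, A (ρ (ofPerm ht s) v) = ψ s (A v)) (v : V)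
    {g : RSp n} (hg : star g * g = idem ht) :
    (toSchutz ht ψ ρ A hA v).1 g = A (ρ (star g) v) := if_pos hg

/-- Any representation attached to `ψ` is isomorphic to the Schützenberger representation. -/
theorem IsAttached.nonempty_equiv (h : IsAttached ht ψ ρ) (hψ : ψ.IsIrreducible) :
    Nonempty (ρ.Equiv (schutzRep ht ψ)) := by
  obtain ⟨f, hf⟩ := h.apex
  -- The projection of `V` onto `e_t V`, followed by the identification with `U`.
  let A : V →ₗ[ℂ] U := f.symm.toLinearMap ∘ₗ (ρ (idem ht)).rangeRestrict
  have hfA : ∀ v, (f (A v) : V) = ρ (idem ht) v := fun v => by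
    change ((f (f.symm _) : LinearMap.range (ρ (idem ht))) : V) = _
    rw [f.apply_symm_apply]
    rfl
  have hA : ∀ s v, A (ρ (ofPerm ht s) v) = ψ s (A v) := fun s v => by
    refine f.injective (Subtype.ext ?_)
    rw [hfA, hf, hfA, ← Module.End.mul_apply, ← Module.End.mul_apply, ← map_mul, ← map_mul,
      idem_mul_ofPerm, ofPerm_mul_idem]
  let F : Representation.IntertwiningMap ρ (schutzRep ht ψ) :=
    { toLinearMap := toSchutz ht ψ ρ A hA
      isIntertwining' := fun m => LinearMap.ext fun v => Subtype.ext (funext fun g => by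
        simp only [LinearMap.comp_apply]
        by_cases hg : star g * g = idem ht
        · rw [toSchutz_apply hA _ hg, ← Module.End.mul_apply, ← map_mul]
          by_cases hm : m * (star m * g) = g
          · rw [schutzRep_apply_of_fixes _ hm,
              toSchutz_apply hA _ ((star_mul_self_of_fixes hm).trans hg), star_mul, star_star]
          · rw [schutzRep_apply_of_not_fixes _ hm, h.rank_lt _ (rank_star_mul_lt ht hg hm)]
            simp
        · rw [apply_eq_zero _ hg, apply_eq_zero _ hg]) }
  have hF : F ≠ 0 := by
    intro h0
    have := nontrivial_of_isIrreducible hψ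
    obtain ⟨u, hu⟩ := exists_ne (0 : U)
    have he : star (idem ht) * idem ht = idem ht := by rw [star_idem, idem_mul_idem]
    have h1 : (toSchutz ht ψ ρ A hA (f u : V)).1 (idem ht) = 0 := by
      have h2 : toSchutz ht ψ ρ A hA = 0 := congrArg (fun G => G.toLinearMap) h0
      rw [h2]
      rfl
    rw [toSchutz_apply hA _ he, star_idem] at h1
    obtain ⟨v, hv⟩ := (f u).2
    have h3 : (f (A (ρ (idem ht) (f u : V))) : V) = f u := by
      rw [hfA, ← hv, ← Module.End.mul_apply, ← Module.End.mul_apply, ← map_mul, ← map_mul,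
        idem_mul_idem, idem_mul_idem]
    rw [h1, map_zero] at h3
    exact hu (f.map_eq_zero_iff.1 (Subtype.ext h3.symm))
  have := h.irreducible
  have := schutzRep_isIrreducible (ht := ht) hψ
  exact ⟨F.ofBijective ((Representation.IsIrreducible.bijective_or_eq_zero F).resolve_right hF)⟩

theorem character_eq_of_equiv {G V W : Type*} [Monoid G] [AddCommGroup V] [Module ℂ V]
    [AddCommGroup W] [Module ℂ W] {ρ : Representation ℂ G V} {σ : Representation ℂ G W}
    (e : ρ.Equiv σ) : ρ.character = σ.character := by
  ext g
  simp [Representation.character, ← e.conj_apply_self]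

/-! ### Restriction to the Weyl group -/

open Representation in
/-- The map `u ⊗ z ↦ [h ⊗ u ⊗ z]` to the representation induced from `S_t × W_{n-t}`. -/
noncomputable abbrev indMk (ht : t ≤ n) (ψ : Representation ℂ (Equiv.Perm (Fin t)) U)
    (h : WSp n) : U ⊗[ℂ] ℂ →ₗ[ℂ]
      IndV (embed ht) (box ψ (Representation.trivial ℂ (WSp (n - t)) ℂ)) :=
  IndV.mk (embed ht) (box ψ (Representation.trivial ℂ (WSp (n - t)) ℂ)) h

open Representation in
/-- The Weyl group equivariant map from the induced representation, `[h ⊗ u ⊗ z] ↦ h⁻¹ (z u)`. -/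
noncomputable def indToSchutz (ht : t ≤ n) (ψ : Representation ℂ (Equiv.Perm (Fin t)) U) :
    IndV (embed ht) (box ψ (Representation.trivial ℂ (WSp (n - t)) ℂ)) →ₗ[ℂ] schutzSpace ht ψ :=
  Coinvariants.lift _
    (TensorProduct.lift ((Finsupp.lift _ ℂ (WSp n) fun h =>
      schutzRep ht ψ (ofWSp n h⁻¹) ∘ₗ delta ht ψ ∘ₗ (TensorProduct.rid ℂ U).toLinearMap) ∘ₗ
      (MonoidAlgebra.coeffLinearEquiv ℂ).toLinearMap))
    fun g => by
      have hcancel : ∀ f, schutzRep ht ψ (ofWSp n (embed ht g)⁻¹)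
          (schutzRep ht ψ (ofWSp n (embed ht g)) f) = f := fun f => by
        rw [← Module.End.mul_apply, ← map_mul, ofWSp_inv_mul, map_one, Module.End.one_apply]
      ext h u
      simp [box, ← schutzRep_embed_delta, hcancel]

open Representation in
theorem indToSchutz_mk (h : WSp n) (u : U) (z : ℂ) :
    indToSchutz ht ψ (indMk ht ψ h (u ⊗ₜ z)) =
      schutzRep ht ψ (ofWSp n h⁻¹) (delta ht ψ (z • u)) := by
  simp [indToSchutz]

open Representation in
/-- Up to a scalar, the inverse of `indToSchutz`: averaging over the Weyl group. -/
noncomputable def schutzToInd (ht : t ≤ n) (ψ : Representation ℂ (Equiv.Perm (Fin t)) U) :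
    schutzSpace ht ψ →ₗ[ℂ] IndV (embed ht) (box ψ (Representation.trivial ℂ (WSp (n - t)) ℂ)) :=
  ∑ w : WSp n, indMk ht ψ w⁻¹ ∘ₗ (TensorProduct.rid ℂ U).symm.toLinearMap ∘ₗ
    LinearMap.proj (ofWSp n w * idem ht) ∘ₗ (schutzSpace ht ψ).subtype

theorem indToSchutz_schutzToInd (f : schutzSpace ht ψ) :
    indToSchutz ht ψ (schutzToInd ht ψ f) = stabCard ht • f := by
  rw [← sum_schutzRep_delta, schutzToInd, LinearMap.sum_apply, map_sum]
  refine Finset.sum_congr rfl fun w _ => ?_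
  have := indToSchutz_mk (ht := ht) (ψ := ψ) w⁻¹ (f.1 (ofWSp n w * idem ht)) 1
  rwa [inv_inv, one_smul] at this

open Representation in
theorem indV_mk_embed (g : Equiv.Perm (Fin t) × WSp (n - t)) (h : WSp n) (u : U) (z : ℂ) :
    indMk ht ψ (embed ht g * h) ((ψ g.1 u) ⊗ₜ z) = indMk ht ψ h (u ⊗ₜ z) := by
  have := Coinvariants.mk_self_apply (Representation.tprod ((leftRegular ℂ (WSp n)).comp
    (embed ht)) (box ψ (Representation.trivial ℂ (WSp (n - t)) ℂ))) g
    (MonoidAlgebra.single h 1 ⊗ₜ (u ⊗ₜ z))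
  refine Eq.trans ?_ this
  simp [box]
  rfl

open Representation in
theorem schutzToInd_indToSchutz
    (x : IndV (embed ht) (box ψ (Representation.trivial ℂ (WSp (n - t)) ℂ))) :
    schutzToInd ht ψ (indToSchutz ht ψ x) = stabCard ht • x := by
  classical
  suffices h : schutzToInd ht ψ ∘ₗ indToSchutz ht ψ = stabCard ht • LinearMap.id from
    LinearMap.congr_fun h x
  refine IndV.hom_ext _ _ fun v => TensorProduct.ext' fun u z => ?_
  have hterm : ∀ w : WSp n, indMk ht ψ w⁻¹
        (((schutzRep ht ψ (ofWSp n v⁻¹) (delta ht ψ (z • u))).1 (ofWSp n w * idem ht)) ⊗ₜ 1) =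
      (if ∃ s, ofWSp n (v * w) * idem ht = ofPerm ht s then (1 : ℂ) else 0) •
        indMk ht ψ v (u ⊗ₜ z) := fun w => by
    rw [schutzRep_ofWSp_apply, inv_inv, ← mul_assoc, ← map_mul]
    split_ifs with hs
    · obtain ⟨s, hs⟩ := hs
      obtain ⟨w', hw'⟩ := exists_eq_embed ht hs
      have hw : w⁻¹ = embed ht (s, w')⁻¹ * v := by
        rw [map_inv, ← hw', mul_inv_rev, inv_mul_cancel_right]
      have hmk := indV_mk_embed (ht := ht) (ψ := ψ) (s, w')⁻¹ v (z • u) 1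
      rw [hs, delta_apply_ofPerm, hw, one_smul]
      refine hmk.trans ?_
      rw [TensorProduct.smul_tmul, smul_eq_mul, mul_one]
    · rw [zero_smul, delta_apply_of_ne _ fun s hs' => hs ⟨s, hs'.symm⟩, TensorProduct.zero_tmul,
        map_zero]
  have hsum : ∑ w : WSp n, (if ∃ s, ofWSp n (v * w) * idem ht = ofPerm ht s
      then (1 : ℂ) else 0) = stabCard ht :=
    Fintype.sum_equiv (Equiv.mulLeft v) _ _ fun w => rfl
  calc schutzToInd ht ψ (indToSchutz ht ψ (indMk ht ψ v (u ⊗ₜ z)))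
      = ∑ w : WSp n, indMk ht ψ w⁻¹
        (((schutzRep ht ψ (ofWSp n v⁻¹) (delta ht ψ (z • u))).1 (ofWSp n w * idem ht)) ⊗ₜ 1) := by
        rw [indToSchutz_mk, schutzToInd, LinearMap.sum_apply]
        rfl
    _ = stabCard ht • indMk ht ψ v (u ⊗ₜ z) := by
        rw [Finset.sum_congr rfl fun w _ => hterm w, ← Finset.sum_smul, hsum]

open Representation in
/-- The restriction of the Schützenberger representation to the Weyl group is the representation
induced from `S_t × W_{n-t}`. -/
noncomputable def indEquivSchutz (ht : t ≤ n) (ψ : Representation ℂ (Equiv.Perm (Fin t)) U) :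
    (Representation.ind (embed ht) (box ψ (Representation.trivial ℂ (WSp (n - t)) ℂ))).Equiv
      ((schutzRep ht ψ).comp (ofWSp n)) :=
  .mk (.ofBijective (indToSchutz ht ψ) (by
    have hc := stabCard_ne_zero ht
    constructor
    · refine (injective_iff_map_eq_zero _).2 fun x hx => ?_
      have := schutzToInd_indToSchutz x
      rw [hx, map_zero] at this
      exact (smul_eq_zero.1 this.symm).resolve_left hc
    · intro f
      refine ⟨schutzToInd ht ψ ((stabCard ht)⁻¹ • f), ?_⟩
      rw [indToSchutz_schutzToInd, smul_inv_smul₀ hc]))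
    fun g => by
      refine IndV.hom_ext _ _ fun h => TensorProduct.ext' fun u z => ?_
      change indToSchutz ht ψ (ind _ _ g (indMk ht ψ h (u ⊗ₜ z))) =
        schutzRep ht ψ (ofWSp n g) (indToSchutz ht ψ (indMk ht ψ h (u ⊗ₜ z)))
      rw [ind_mk, indToSchutz_mk, indToSchutz_mk, ← Module.End.mul_apply, ← map_mul, ← map_mul,
        mul_inv_rev, inv_inv]

theorem schutzRep_character_ofWSp (w : WSp n) :
    (schutzRep ht ψ).character (ofWSp n w) = (Representation.ind (embed ht)
      (box ψ (Representation.trivial ℂ (WSp (n - t)) ℂ))).character w :=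
  (congrFun (character_eq_of_equiv (indEquivSchutz ht ψ)) w).symm

/-! ### Existence in the lowest universe -/

theorem IsAttached.of_equiv {U' : Type*} [AddCommGroup U'] [Module ℂ U']
    {ψ' : Representation ℂ (Equiv.Perm (Fin t)) U'} (h : IsAttached ht ψ' ρ) (e : U ≃ₗ[ℂ] U')
    (he : ∀ s u, e (ψ s u) = ψ' s (e u)) : IsAttached ht ψ ρ where
  irreducible := h.irreducible
  rank_lt := h.rank_lt
  apex := by
    obtain ⟨f, hf⟩ := h.apex
    refine ⟨e.trans f, fun s u => ?_⟩
    rw [LinearEquiv.trans_apply, LinearEquiv.trans_apply, he, hf]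

theorem isIrreducible_of_linearEquiv {G V W : Type*} [Monoid G] [AddCommGroup V] [Module ℂ V]
    [AddCommGroup W] [Module ℂ W] {ρ : Representation ℂ G V} {σ : Representation ℂ G W}
    (e : V ≃ₗ[ℂ] W) (he : ∀ g v, e (ρ g v) = σ g (e v)) (h : ρ.IsIrreducible) :
    σ.IsIrreducible := by
  have := nontrivial_of_isIrreducible h
  have : Nontrivial W := e.symm.toEquiv.nontrivial
  refine isIrreducible_of_forall fun Y w hw hw0 => eq_top_iff.2 fun w' _ => ?_
  let Z : Subrepresentation ρ := ⟨Y.toSubmodule.comap e.toLinearMap, fun g v hv => by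
    have := Y.apply_mem_toSubmodule g hv
    rwa [Submodule.mem_comap, LinearEquiv.coe_coe, he]⟩
  have hZ : Z.toSubmodule = ⊤ := eq_top_of_isIrreducible h Z (v := e.symm w)
    (by simpa [Z] using hw) (by simpa using hw0)
  have : e.symm w' ∈ Z.toSubmodule := hZ ▸ Submodule.mem_top
  simpa [Z] using this

/-- A finite-dimensional representation is isomorphic to one on a coordinate space. -/
theorem exists_linearEquiv_fin {G : Type*} [Monoid G] [FiniteDimensional ℂ U]
    (ψ : Representation ℂ G U) :
    ∃ (ψ' : Representation ℂ G (Fin (Module.finrank ℂ U) → ℂ))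
      (e : U ≃ₗ[ℂ] (Fin (Module.finrank ℂ U) → ℂ)), ∀ g u, e (ψ g u) = ψ' g (e u) := by
  let e : U ≃ₗ[ℂ] (Fin (Module.finrank ℂ U) → ℂ) := (Module.finBasis ℂ U).equivFun
  refine ⟨(e.conjAlgEquiv ℂ : Module.End ℂ U →* _).comp ψ, e, fun g u => ?_⟩
  simp [LinearEquiv.conjAlgEquiv]

end

end SymplecticRook

open SymplecticRook in
theorem proposition5p2 (n t : ℕ) (ht : t ≤ n)
    {U : Type*} [AddCommGroup U] [Module ℂ U] [FiniteDimensional ℂ U]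
    (ψ : Representation ℂ (Equiv.Perm (Fin t)) U) (hψ : ψ.IsIrreducible) :
    (∃! χ : RSp n → ℂ, IsAttachedCharacter ht ψ χ) ∧
    ∀ χ : RSp n → ℂ, IsAttachedCharacter ht ψ χ → ∀ w : WSp n,
      χ (ofWSp n w) = (Representation.ind (embed ht)
        (box ψ (Representation.trivial ℂ (WSp (n - t)) ℂ))).character w := by
  have huniq : ∀ χ, IsAttachedCharacter ht ψ χ → χ = (schutzRep ht ψ).character := by
    rintro χ ⟨V, _, _, _, ρ, hρ, rfl⟩
    obtain ⟨e⟩ := hρ.nonempty_equiv hψ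
    exact character_eq_of_equiv e
  refine ⟨?_, fun χ hχ w => ?_⟩
  · obtain ⟨ψ', e, he⟩ := exists_linearEquiv_fin ψ
    have h : IsAttachedCharacter ht ψ (schutzRep ht ψ').character :=
      ⟨schutzSpace ht ψ', inferInstance, inferInstance, inferInstance, schutzRep ht ψ',
        (schutzRep_isAttached (isIrreducible_of_linearEquiv e he hψ)).of_equiv e he, rfl⟩
    exact ⟨_, h, fun χ hχ => (huniq χ hχ).trans (huniq _ h).symm⟩
  · rw [huniq χ hχ]
    exact schutzRep_character_ofWSp w
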